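/- Fix $n\ge 2$ strands, numbered from bottom to top. Let $u\in S_n$, let $\beta'=\sigma_{i_2}\cdots\sigma_{i_k}$ be a positive braid word such that some reduced word of $u$ is a subword of $\beta'$, and let $\beta=\sigma_i\beta'$, where $1\le i\le n-1$. **The matrix $\widehat B^{u,\beta}$.** For a word $\beta=\sigma_{i_1}\cdots\sigma_{i_k}$ containing a reduced word of $u$ as a subword, put $u_k=u$ and $u_{j-1}=u_js_{i_j}$ if $\ell(u_js_{i_j})<\ell(u_j)$, $u_{j-1}=u_j$ otherwise. In the 3D plabic graph $G_{u,\beta}$, letter $j$ is drawn, from left to right, as a *bridge* between strands $i_j,i_j+1$ if $u_{j-1}=u_j$, and otherwise as a *crossing* of these strands, in which the strand going from lower left to upper right is in front. Each bridge starts a *soap film*, which fills the region immediately to the left of the bridge and propagates to the left: at a crossing it stays attached to the same strands, and at a bridge it is unchanged if it passes over the top strand or under the bottom strand of the bridge, and otherwise it is cut, i.e. removed from the region to the left of the bridge. A film is *frozen* if it reaches the left border and *mutable* otherwise. Let $C_1,\dots,C_{m+f}$ be the $m$ mutable films followed by the $f$ frozen ones, each group listed from left to right by their bridges. Let $\partial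 C_x\in\{0,1\}^{n-1}$ record which of the $n-1$ regions at the left border are covered by $C_x$. Around each bridge let $a,b,c,d$ be the regions above, right, below and left; there are two half arrows $d\to b$ and one half arrow each $b\to a$, $a\to d$, $b\to c$, $c\to d$. Let $h(x,y)$ be the number of half arrows, over all bridges, whose source is covered by $C_x$ and whose target is covered by $C_y$ (a region covered by several films counts for each). Then $$\widehat b_{y,x}=\tfrac12\bigl(h(y,x)-h(x,y)\bigr)+(\partial C_y)^T M\,(\partial C_x),$$ where $M$ is $-\tfrac12$ times the Cartan matrix of type $A_{n-1}$. **Lemma.** The matrices $\widehat B^{u,\beta'}$ and $\widehat B^{u,\beta}=(\widehat b_{y,x})$ are invertible; let $A^{u,\beta'}$ and $A^{u,\beta}$ be their inverses. Let $m$ be the number of mutable films of $G_{u,\beta}$. The leftmost letter $\sigma_i$ of $\beta$ is a bridge of $G_{u,\beta}$; its film is frozen and has index $m+1$. The other bridges of $G_{u,\beta}$ are the bridges of $G_{u,\beta'}$. Let $Z_1$ be the matrix obtained from $\widehat B^{u,\beta'}$ by relabelling its rows and columns according to this identification of bridges and adding an $(m+1)$-st row and column with $-1$ on the diagonal and $0$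 elsewhere. Define $L=(\ell_{yx})$ and $R=(r_{yx})$ by $$\ell_{yx}=\begin{cases}1&y=x\\ \widehat b_{y,m+1}&x=m+1,\ y\ne m+1\\0&\text{otherwise,}\end{cases}\qquad r_{yx}=\begin{cases}1&y=x\\ \widehat b_{m+1,x}&y=m+1,\ x\neq m+1\\0&\text{otherwise.}\end{cases}$$ Then $Z_1$ is invertible, $Z_1^{-1}$ is obtained from $A^{u,\beta'}$ by the same relabelling and by adding an $(m+1)$-st row and column with $-1$ on the diagonal and $0$ elsewhere, and $$A^{u,\beta}=R\,Z_1^{-1}L .$$ -/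

import Mathlib

namespace BraidQuiver

/-!
Conventions.  There are `n + 1` strands, numbered `0, …, n` from bottom to top, and `n` Artin
generators: the letter `i : Fin n` acts on the strands at heights `i` and `i + 1`.  A braid word is
a list of letters, read from left to right.  "Slice `j`" of a word `β` is the vertical line
immediately to the left of the letter number `j` (counted from `0`), so that slice `0` is the
leftmost border.
-/

/-- A positive braid word on `n + 1` strands. -/
abbrev Word (n : ℕ) := List (Fin n)

/-- The simple transposition `s_i` exchanging `i` and `i + 1`. -/
def simpleRefl {n : ℕ} (i : Fin n) : Equiv.Perm (Fin (n + 1)) :=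
  Equiv.swap i.castSucc i.succ

/-- The permutation `s_{i₁} s_{i₂} ⋯ s_{i_k}` of a word. -/
def wordProd {n : ℕ} (w : Word n) : Equiv.Perm (Fin (n + 1)) :=
  (w.map simpleRefl).prod

/-- The Coxeter length: the least length of a word in the simple transpositions. -/
noncomputable def permLength {n : ℕ} (v : Equiv.Perm (Fin (n + 1))) : ℕ :=
  sInf {k | ∃ w : Word n, wordProd w = v ∧ w.length = k}

/-- A word is reduced if no shorter word has the same product. -/
def IsReduced {n : ℕ} (w : Word n) : Prop :=
  w.length = permLength (wordProd w)

/-- `u` is a subword of `β`: some reduced word of `u` is a (not necessarily contiguous) subword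
of `β`. -/
def IsSubword {n : ℕ} (u : Equiv.Perm (Fin (n + 1))) (β : Word n) : Prop :=
  ∃ w : Word n, w.Sublist β ∧ IsReduced w ∧ wordProd w = u

/-- The Demazure quotient `v ◁ s_i`. -/
noncomputable def demazureQuot {n : ℕ} (v : Equiv.Perm (Fin (n + 1))) (i : Fin n) :
    Equiv.Perm (Fin (n + 1)) :=
  if permLength (v * simpleRefl i) < permLength v then v * simpleRefl i else v

/-- The last permutation `u_0` of the sequence `u_k = u`, `u_{j-1} = u_j ◁ s_{i_j}` of a word of
length `k`.  The permutation `u_j` of the word `β` is `demazureSeq u (β.drop j)`. -/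
noncomputable def demazureSeq {n : ℕ} (u : Equiv.Perm (Fin (n + 1))) :
    Word n → Equiv.Perm (Fin (n + 1))
  | [] => u
  | i :: γ => demazureQuot (demazureSeq u γ) i

/-- The letter number `j` (counted from `0`) of `β` is drawn as a bridge, that is, the two
permutations `u_{j+1}` and `u_j` on its two sides agree; otherwise it is drawn as a positive
crossing. -/
def IsBridge {n : ℕ} (u : Equiv.Perm (Fin (n + 1))) (β : Word n) (j : Fin β.length) : Prop :=
  demazureSeq u (β.drop (j + 1)) = demazureSeq u (β.drop j)

/-- The bridges of the 3D plabic graph `G_{u,β}`; they index the soap films. -/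
def Bridge {n : ℕ} (u : Equiv.Perm (Fin (n + 1))) (β : Word n) : Type :=
  {j : Fin β.length // IsBridge u β j}

noncomputable instance {n : ℕ} (u : Equiv.Perm (Fin (n + 1))) (β : Word n) :
    DecidablePred (IsBridge u β) := fun _ => inferInstanceAs (Decidable (_ = _))

noncomputable instance {n : ℕ} (u : Equiv.Perm (Fin (n + 1))) (β : Word n) :
    Fintype (Bridge u β) :=
  inferInstanceAs (Fintype {j : Fin β.length // IsBridge u β j})

/-- The position of a bridge in the word. -/
def Bridge.pos {n : ℕ} {u : Equiv.Perm (Fin (n + 1))} {β : Word n} (x : Bridge u β) :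
    Fin β.length :=
  Subtype.val x

/-- The letter of a bridge. -/
def Bridge.letter {n : ℕ} {u : Equiv.Perm (Fin (n + 1))} {β : Word n} (x : Bridge u β) : Fin n :=
  β.get x.pos

/-- The trace of a soap film on a vertical line.  `bd k` records how the film is attached to the
strand at height `k`: it is `1` if the film clings to this strand from above, `-1` if it clings to
it from below, and `0` if the strand is not on the boundary of the film.  For a strand which the
film passes, `front k` tells whether it passes over (`true`) or under (`false`) that strand; for the
other strands the value of `front` is irrelevant. -/
structure Slice (n : ℕ) where
  bd : Fin (n + 1) → ℤ
  front : Fin (n + 1) → Bool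

namespace Slice

variable {n : ℕ}

/-- The multiplicity (`1` if covered, `0` if not) of the film just above the strand at height `k`.
A film is bounded by the strands it is attached to, so this is the total attachment at or below
height `k`. -/
def above (s : Slice n) (k : Fin (n + 1)) : ℤ := ∑ l ∈ Finset.Iic k, s.bd l

/-- The multiplicity of the film just below the strand at height `k`. -/
def below (s : Slice n) (k : Fin (n + 1)) : ℤ := ∑ l ∈ Finset.Iio k, s.bd l

/-- The film passes over or under the strand at height `k`, as it is present on both sides. -/
def Passes (s : Slice n) (k : Fin (n + 1)) : Prop := s.below k ≠ 0 ∧ s.above k ≠ 0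

instance (s : Slice n) (k : Fin (n + 1)) : Decidable (s.Passes k) :=
  inferInstanceAs (Decidable (_ ∧ _))

/-- No film. -/
def empty : Slice n := ⟨fun _ => 0, fun _ => false⟩

/-- A film immediately to the left of the bridge `i` at which it starts: it fills the gap between
the strands `i` and `i + 1`. -/
def start (i : Fin n) : Slice n :=
  ⟨Pi.single i.castSucc 1 - Pi.single i.succ 1, fun _ => false⟩

/-- Propagation from right to left through a positive crossing `i`.  The film stays attached to the
same strands, which exchange their heights; the strand descending to height `i` runs over the one
ascending to height `i + 1`.  A strand which the film already passes keeps its side.  A strand which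
the film newly passes does so because a boundary strand of the film has crossed it: the film
passes under the strand now at height `i`, and over the strand now at height `i + 1`. -/
def throughCrossing (i : Fin n) (s : Slice n) : Slice n where
  bd := s.bd ∘ simpleRefl i
  front k :=
    if k = i.castSucc then (if s.Passes i.succ then s.front i.succ else false)
    else if k = i.succ then (if s.Passes i.castSucc then s.front i.castSucc else true)
    else s.front k

/-- Propagation from right to left past a bridge `i`.  A film passing over the top strand or
under the bottom strand of the bridge does not change; otherwise it is cut, which removes it from
the gap between the two strands. -/
def throughBridge (i : Fin n) (s : Slice n) : Slice n :=
  if (s.Passes i.succ ∧ s.front i.succ = true) ∨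
      (s.Passes i.castSucc ∧ s.front i.castSucc = false) then s
  else ⟨s.bd - s.above i.castSucc • (Pi.single i.castSucc 1 - Pi.single i.succ 1), s.front⟩

end Slice

/-- The trace, on the leftmost border of `G_{u,β}`, of the soap film starting at the letter number
`l` of `β`. -/
noncomputable def leftSlice {n : ℕ} (u : Equiv.Perm (Fin (n + 1))) : Word n → ℕ → Slice n
  | [], _ => Slice.empty
  | i :: _, 0 => Slice.start i
  | i :: γ, l + 1 =>
    if demazureSeq u γ = demazureSeq u (i :: γ) then (leftSlice u γ l).throughBridge i
    else (leftSlice u γ l).throughCrossing i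

/-- The trace of the soap film `C_x` on the slice `j` of `G_{u,β}`: a film extends from its bridge to
the left. -/
noncomputable def film {n : ℕ} {u : Equiv.Perm (Fin (n + 1))} {β : Word n} (x : Bridge u β)
    (j : ℕ) : Slice n :=
  if j ≤ (x.pos : ℕ) then leftSlice u (β.drop j) ((x.pos : ℕ) - j) else Slice.empty

/-- The boundary map `∂`: the multiplicities of the film in the `n` regions at the leftmost
border. -/
noncomputable def boundary {n : ℕ} {u : Equiv.Perm (Fin (n + 1))} {β : Word n} (x : Bridge u β) :
    Fin n → ℤ :=
  fun l => (film x 0).above l.castSucc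

/-- A vertex is mutable if its soap film is bounded, that is, does not reach the leftmost border,
and frozen otherwise. -/
def IsFrozen {n : ℕ} {u : Equiv.Perm (Fin (n + 1))} {β : Word n} (x : Bridge u β) : Prop :=
  boundary x ≠ 0

noncomputable instance {n : ℕ} {u : Equiv.Perm (Fin (n + 1))} {β : Word n} :
    DecidablePred (IsFrozen : Bridge u β → Prop) := fun _ => inferInstanceAs (Decidable (_ ≠ _))

/-- Films are ordered with the mutable ones first and then from left to right. -/
noncomputable def filmKey {n : ℕ} {u : Equiv.Perm (Fin (n + 1))} {β : Word n} (x : Bridge u β) :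
    Bool ×ₗ Fin β.length :=
  toLex (decide (IsFrozen x), x.pos)

theorem filmKey_injective {n : ℕ} {u : Equiv.Perm (Fin (n + 1))} {β : Word n} :
    Function.Injective (filmKey : Bridge u β → Bool ×ₗ Fin β.length) := by
  intro x y h
  have h2 := congrArg (fun z => (ofLex z).2) h
  exact Subtype.ext h2

noncomputable instance {n : ℕ} {u : Equiv.Perm (Fin (n + 1))} {β : Word n} :
    LinearOrder (Bridge u β) := LinearOrder.lift' filmKey filmKey_injective

/-- The number `m + f` of vertices of the quiver `Q_{u,β}`. -/
noncomputable def numFilms {n : ℕ} (u : Equiv.Perm (Fin (n + 1))) (β : Word n) : ℕ :=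
  Fintype.card (Bridge u β)

/-- The number `m` of mutable vertices of the quiver `Q_{u,β}`. -/
noncomputable def numMutable {n : ℕ} (u : Equiv.Perm (Fin (n + 1))) (β : Word n) : ℕ :=
  Fintype.card {x : Bridge u β // ¬ IsFrozen x}

/-- The increasing enumeration of the soap films (counted from `0`). -/
noncomputable def label {n : ℕ} (u : Equiv.Perm (Fin (n + 1))) (β : Word n) :
    Fin (numFilms u β) ≃o Bridge u β :=
  monoEquivOfFin (Bridge u β) rfl

/-- The number of half arrows from `x` to `y`.  Near a bridge, let `a`, `b`, `c`, `d` be the regions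
above, to the right of, below and to the left of it.  The half arrow configuration consists of two
half arrows `d → b` and of one half arrow each of the forms `b → a`, `a → d`, `b → c`, `c → d`; a
half arrow between two regions contributes one from `x` to `y` whenever `C_x` covers its source
and `C_y` its target. -/
noncomputable def halfArrows {n : ℕ} {u : Equiv.Perm (Fin (n + 1))} {β : Word n}
    (x y : Bridge u β) : ℤ :=
  ∑ p : Bridge u β,
    let j : ℕ := p.pos
    let i := p.letter
    let a := fun z : Bridge u β => (film z j).above i.succ
    let b := fun z : Bridge u β => (film z (j + 1)).above i.castSucc
    let c := fun z : Bridge u β => (film z j).below i.castSucc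
    let d := fun z : Bridge u β => (film z j).above i.castSucc
    2 * (d x * b y) + b x * a y + a x * d y + b x * c y + c x * d y

/-- The half arrow matrix `H^{u,β}`. -/
noncomputable def halfArrowMatrix {n : ℕ} (u : Equiv.Perm (Fin (n + 1))) (β : Word n) :
    Matrix (Fin (numFilms u β)) (Fin (numFilms u β)) ℚ :=
  Matrix.of fun i j =>
    (1 / 2 : ℚ) * (halfArrows (label u β i) (label u β j) - halfArrows (label u β j) (label u β i))

/-- The matrix `-1/2` times the Cartan matrix of type `A_n`. -/
def correctionGram (n : ℕ) : Matrix (Fin n) (Fin n) ℚ :=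
  Matrix.of fun i j =>
    if i = j then -1 else if (i : ℕ) + 1 = j ∨ (j : ℕ) + 1 = i then 1 / 2 else 0

/-- The boundary correction form. -/
def correctionForm {n : ℕ} (a b : Fin n → ℤ) : ℚ :=
  ∑ i, ∑ j, (a i : ℚ) * (b j : ℚ) * correctionGram n i j

/-- The boundary correction matrix `D^{u,β}`. -/
noncomputable def correctionMatrix {n : ℕ} (u : Equiv.Perm (Fin (n + 1))) (β : Word n) :
    Matrix (Fin (numFilms u β)) (Fin (numFilms u β)) ℚ :=
  Matrix.of fun i j => correctionForm (boundary (label u β i)) (boundary (label u β j))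

/-- The matrix `B̂^{u,β} = H^{u,β} + D^{u,β}`. -/
noncomputable def bHat {n : ℕ} (u : Equiv.Perm (Fin (n + 1))) (β : Word n) :
    Matrix (Fin (numFilms u β)) (Fin (numFilms u β)) ℚ :=
  halfArrowMatrix u β + correctionMatrix u β

/-- The inverse matrix `A^{u,β}` of `B̂^{u,β}`. -/
noncomputable def aMatrix {n : ℕ} (u : Equiv.Perm (Fin (n + 1))) (β : Word n) :
    Matrix (Fin (numFilms u β)) (Fin (numFilms u β)) ℚ :=
  (bHat u β)⁻¹

/-- The unipotent matrix `L` built from the column `p` of `B`. -/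
def leftFactor {ι : Type*} [DecidableEq ι] (B : Matrix ι ι ℚ) (p : ι) : Matrix ι ι ℚ :=
  Matrix.of fun y x => if y = x then 1 else if x = p then B y p else 0

/-- The unipotent matrix `R` built from the row `p` of `B`. -/
def rightFactor {ι : Type*} [DecidableEq ι] (B : Matrix ι ι ℚ) (p : ι) : Matrix ι ι ℚ :=
  Matrix.of fun y x => if y = x then 1 else if y = p then B p x else 0

/-- The matrix `M` with a new row and column (indexed by `none`) added, with `-1` on the diagonal
and `0` elsewhere. -/
def bordered {ι : Type*} (M : Matrix ι ι ℚ) : Matrix (Option ι) (Option ι) ℚ :=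
  Matrix.of fun y x =>
    match y, x with
    | none, none => -1
    | some y, some x => M y x
    | _, _ => 0

end BraidQuiver

/-!
For `B = B̂^{u,σ_iβ'}` and `p` the leftmost bridge one has `B p p = -1`, so `L B R = Z₁` amounts to
the rank-one identity `B y x + B y p * B p x = B' y x` for the old bridges `y`, `x`.  The formula for
`A^{u,β}` and the invertibility of `B` follow from `L B R = Z₁` and the invertibility of `B'`
(`inverse_formula`).

The identity is local.  Let `a, b, c, d` be the multiplicities of a film in the four regions around
the bridge `p`.  In terms of the attachment vectors `bd`, which lie in the span of the simple roots
`α_k`, the correction form is `-1/2` times the standard inner product (`correctionForm_boundary`),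
and passing the bridge `p` replaces `bd` by `bd + (d - b) α_i` whether or not the film is cut.
Hence `B p x = b_x - d_x` and `B y p = a_y + c_y - b_y - d_y`, and the identity becomes a polynomial
identity in the multiplicities (`bEntry_schur`).

A crossing only permutes the coordinates of `bd` and contributes no half arrows, so it leaves the
matrix unchanged (`bEntry_lift_of_crossing`).  Invertibility of `B̂` therefore holds for every word,
by induction on its length (`isUnit_det_bHat`).

That the first letter of `σ_iβ'` is a bridge means that the sequence `u_j` of `β'` ends at the
identity; this follows from the exchange property of the symmetric group
(`demazureSeq_eq_one_of_isSubword`).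
-/

namespace BraidQuiver

/-! ### The exchange property and the Demazure quotients -/

section Exchange

variable {n : ℕ}

@[simp] theorem simpleRefl_mul_self (i : Fin n) : simpleRefl i * simpleRefl i = 1 :=
  Equiv.swap_mul_self _ _

@[simp] theorem wordProd_nil : wordProd ([] : Word n) = 1 := rfl

@[simp] theorem wordProd_cons (i : Fin n) (w : Word n) :
    wordProd (i :: w) = simpleRefl i * wordProd w := by
  simp [wordProd]

theorem wordProd_append (v w : Word n) : wordProd (v ++ w) = wordProd v * wordProd w := by
  simp [wordProd]

theorem wordProd_concat (w : Word n) (i : Fin n) :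
    wordProd (w ++ [i]) = wordProd w * simpleRefl i := by
  simp [wordProd_append]

theorem permLength_wordProd_le (w : Word n) : permLength (wordProd w) ≤ w.length :=
  Nat.sInf_le ⟨w, rfl, rfl⟩

theorem exists_reduced_of_wordProd (w : Word n) :
    ∃ w' : Word n, wordProd w' = wordProd w ∧ w'.length = permLength (wordProd w) :=
  Nat.sInf_mem (s := {k | ∃ w' : Word n, wordProd w' = wordProd w ∧ w'.length = k})
    ⟨_, w, rfl, rfl⟩

theorem permLength_one : permLength (1 : Equiv.Perm (Fin (n + 1))) = 0 :=
  Nat.le_zero.1 (permLength_wordProd_le ([] : Word n))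

/-- A simple transposition reverses the order of a pair only if the pair is the one it swaps. -/
theorem eq_of_simpleRefl_reverses {i : Fin n} {a b : Fin (n + 1)} (hab : a < b)
    (h : simpleRefl i b < simpleRefl i a) : a = i.castSucc ∧ b = i.succ := by
  have hs : ∀ c : Fin (n + 1), (c = i.castSucc ∧ simpleRefl i c = i.succ) ∨
      (c = i.succ ∧ simpleRefl i c = i.castSucc) ∨
      (c ≠ i.castSucc ∧ c ≠ i.succ ∧ simpleRefl i c = c) := by
    intro c
    by_cases h1 : c = i.castSucc
    · exact Or.inl ⟨h1, by simp [h1, simpleRefl]⟩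
    by_cases h2 : c = i.succ
    · exact Or.inr (Or.inl ⟨h2, by simp [h2, simpleRefl]⟩)
    exact Or.inr (Or.inr ⟨h1, h2, Equiv.swap_apply_of_ne_of_ne h1 h2⟩)
  rcases hs a with ⟨ha, ha'⟩ | ⟨ha, ha'⟩ | ⟨ha, ha2, ha'⟩ <;>
    rcases hs b with ⟨hb, hb'⟩ | ⟨hb, hb'⟩ | ⟨hb, hb2, hb'⟩ <;>
    rw [ha', hb'] at h <;>
    simp only [Fin.lt_def, Fin.ext_iff, Fin.val_castSucc, Fin.val_succ, ne_eq] at * <;> omega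

/-- Exchange property: a descent of the product of a word is obtained by deleting a letter. -/
theorem exists_sublist_of_descent (i : Fin n) (w : Word n)
    (h : wordProd w i.succ < wordProd w i.castSucc) :
    ∃ w' : Word n, w'.Sublist w ∧ w'.length + 1 = w.length ∧
      wordProd w' = wordProd w * simpleRefl i := by
  induction w with
  | nil => simp [Fin.lt_def] at h
  | cons k w ih =>
    by_cases hw : wordProd w i.succ < wordProd w i.castSucc
    · obtain ⟨w', hs, hl, hp⟩ := ih hw
      exact ⟨k :: w', hs.cons_cons k, by simp [hl], by simp [hp, mul_assoc]⟩
    · have hlt : wordProd w i.castSucc < wordProd w i.succ :=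
        lt_of_le_of_ne (not_lt.1 hw) fun he =>
          (Fin.castSucc_lt_succ (i := i)).ne ((wordProd w).injective he)
      obtain ⟨h1, h2⟩ := eq_of_simpleRefl_reverses (i := k) hlt (by simpa using h)
      refine ⟨w, List.sublist_cons_self k w, by simp, ?_⟩
      -- The product of `w` conjugates `s_i` to `s_k`.
      have hc : simpleRefl k * wordProd w = wordProd w * simpleRefl i := by
        rw [simpleRefl, ← h1, ← h2, simpleRefl, Equiv.mul_swap_eq_swap_mul]
      rw [wordProd_cons, hc, mul_assoc, simpleRefl_mul_self, mul_one]

theorem descent_of_permLength_lt (i : Fin n) (w : Word n)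
    (h : permLength (wordProd w * simpleRefl i) < permLength (wordProd w)) :
    wordProd w i.succ < wordProd w i.castSucc := by
  by_contra hw
  have hlt : wordProd w i.castSucc < wordProd w i.succ :=
    lt_of_le_of_ne (not_lt.1 hw) fun he =>
      (Fin.castSucc_lt_succ (i := i)).ne ((wordProd w).injective he)
  obtain ⟨v, hv, hvl⟩ := exists_reduced_of_wordProd (w ++ [i])
  rw [wordProd_concat] at hv hvl
  -- As `i` is a descent of `wordProd w * s_i`, deleting a letter of `v` gives a word of
  -- `wordProd w`.
  obtain ⟨v', -, hl, hp⟩ := exists_sublist_of_descent i v (by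
    rw [hv]; simpa [simpleRefl] using hlt)
  rw [hv, mul_assoc, simpleRefl_mul_self, mul_one] at hp
  have := permLength_wordProd_le v'
  rw [hp] at this
  omega

theorem demazureSeq_concat (u : Equiv.Perm (Fin (n + 1))) (β : Word n) (i : Fin n) :
    demazureSeq u (β ++ [i]) = demazureSeq (demazureQuot u i) β := by
  induction β with
  | nil => rfl
  | cons k β ih => simp [demazureSeq, ih]

theorem permLength_le_mul_simpleRefl_add_one (w : Word n) (i : Fin n) :
    permLength (wordProd w) ≤ permLength (wordProd w * simpleRefl i) + 1 := by
  obtain ⟨v, hv, hvl⟩ := exists_reduced_of_wordProd (w ++ [i])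
  rw [wordProd_concat] at hv hvl
  have := permLength_wordProd_le (v ++ [i])
  rw [wordProd_concat, hv, mul_assoc, simpleRefl_mul_self, mul_one] at this
  simp at this
  omega

/-- Reading the last letter of a word replaces `u` by its Demazure quotient, which is a subword of
the remaining letters. -/
theorem isSubword_demazureQuot {u : Equiv.Perm (Fin (n + 1))} {β : Word n} {i : Fin n}
    (h : IsSubword u (β ++ [i])) : IsSubword (demazureQuot u i) β := by
  obtain ⟨w, hw, hr, rfl⟩ := h
  obtain ⟨w₁, w₂, rfl, h₁, h₂⟩ := List.sublist_append_iff.1 hw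
  have h₂' : w₂ = [] ∨ w₂ = [i] := by
    simpa using List.sublist_singleton.1 h₂
  rcases h₂' with rfl | rfl
  · rw [List.append_nil] at hr ⊢
    unfold demazureQuot
    split_ifs with hlt
    · obtain ⟨w', hs, hl, hp⟩ := exists_sublist_of_descent i w₁ (descent_of_permLength_lt i w₁ hlt)
      refine ⟨w', hs.trans h₁, ?_, hp⟩
      have h3 := permLength_le_mul_simpleRefl_add_one w₁ i
      have h4 := permLength_wordProd_le w'
      unfold IsReduced at hr ⊢
      rw [hp] at h4 ⊢
      omega
    · exact ⟨w₁, h₁, hr, rfl⟩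
  · have h4 := permLength_wordProd_le w₁
    have h3 := permLength_le_mul_simpleRefl_add_one (w₁ ++ [i]) i
    unfold IsReduced at hr
    have he : wordProd (w₁ ++ [i]) * simpleRefl i = wordProd w₁ := by
      rw [wordProd_concat, mul_assoc, simpleRefl_mul_self, mul_one]
    rw [he] at h3
    simp only [List.length_append, List.length_singleton] at hr
    rw [demazureQuot, he, if_pos (by omega)]
    exact ⟨w₁, h₁, by unfold IsReduced; omega, rfl⟩

theorem demazureSeq_eq_one_of_isSubword {u : Equiv.Perm (Fin (n + 1))} {β : Word n}
    (h : IsSubword u β) : demazureSeq u β = 1 := by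
  induction β using List.reverseRecOn generalizing u with
  | nil =>
    obtain ⟨w, hw, -, rfl⟩ := h
    rw [List.sublist_nil.1 hw]
    rfl
  | append_singleton β i ih =>
    rw [demazureSeq_concat]
    exact ih (isSubword_demazureQuot h)

theorem demazureQuot_one (i : Fin n) : demazureQuot 1 i = 1 :=
  if_neg (by simp [permLength_one])

end Exchange

/-! ### The correction form as an inner product -/

section Slices

variable {n : ℕ}

/-- The simple root `e_i - e_{i+1}` of type `A_n`. -/
def simpleRoot (i : Fin n) : Fin (n + 1) → ℤ :=
  Pi.single i.castSucc 1 - Pi.single i.succ 1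

/-- The sum of all attachments of a film trace; it vanishes for the traces of soap films. -/
def Slice.total (s : Slice n) : ℤ := ∑ k, s.bd k

theorem Slice.above_last (s : Slice n) : s.above (Fin.last n) = s.total := by
  unfold Slice.above Slice.total
  exact Finset.sum_congr (by ext k; simp [Fin.le_last]) fun _ _ => rfl

theorem Slice.below_zero (s : Slice n) : s.below 0 = 0 :=
  Finset.sum_eq_zero fun k hk => absurd (Finset.mem_Iio.1 hk) (Fin.not_lt_zero k)

theorem Slice.below_succ (s : Slice n) (i : Fin n) : s.below i.succ = s.above i.castSucc := by
  unfold Slice.above Slice.below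
  exact Finset.sum_congr (by ext k; simp [Fin.lt_def, Fin.le_def]) fun _ _ => rfl

theorem Slice.above_eq_below_add (s : Slice n) (k : Fin (n + 1)) :
    s.above k = s.below k + s.bd k := by
  unfold Slice.above Slice.below
  rw [← Finset.Iio_insert, Finset.sum_insert (by simp), add_comm]

/-- A trace of total attachment zero is the combination of simple roots whose coefficients are its
multiplicities in the regions. -/
theorem Slice.bd_eq_sum_simpleRoot {s : Slice n} (h : s.total = 0) (k : Fin (n + 1)) :
    s.bd k = ∑ i : Fin n, s.above i.castSucc * simpleRoot i k := by
  have h1 : ∑ i : Fin n, s.above i.castSucc * (Pi.single i.castSucc (1 : ℤ) : Fin (n + 1) → ℤ) k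
      = s.above k := by
    have := Fin.sum_univ_castSucc
      (fun l => s.above l * (Pi.single l (1 : ℤ) : Fin (n + 1) → ℤ) k)
    rw [s.above_last, h, zero_mul, add_zero] at this
    rw [← this]
    simp [Pi.single_apply]
  have h2 : ∑ i : Fin n, s.above i.castSucc * (Pi.single i.succ (1 : ℤ) : Fin (n + 1) → ℤ) k
      = s.below k := by
    have := Fin.sum_univ_succ
      (fun l => s.below l * (Pi.single l (1 : ℤ) : Fin (n + 1) → ℤ) k)
    rw [s.below_zero, zero_mul, zero_add] at this
    simp only [Slice.below_succ] at this
    rw [← this]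
    simp [Pi.single_apply]
  simp only [simpleRoot, Pi.sub_apply, mul_sub, Finset.sum_sub_distrib, h1, h2]
  rw [s.above_eq_below_add]
  ring

theorem sum_mul_simpleRoot (f : Fin (n + 1) → ℤ) (i : Fin n) :
    ∑ k, f k * simpleRoot i k = f i.castSucc - f i.succ := by
  simp [simpleRoot, mul_sub, Pi.single_apply]

theorem correctionGram_eq (i j : Fin n) :
    correctionGram n i j = -(1 / 2) * ((∑ k, simpleRoot i k * simpleRoot j k : ℤ) : ℚ) := by
  rw [sum_mul_simpleRoot]
  simp only [correctionGram, Matrix.of_apply, simpleRoot, Pi.sub_apply, Pi.single_apply,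
    Fin.ext_iff, Fin.val_castSucc, Fin.val_succ]
  split_ifs <;> first | omega | norm_num

theorem correctionForm_above {s t : Slice n} (hs : s.total = 0) (ht : t.total = 0) :
    correctionForm (fun l => s.above l.castSucc) (fun l => t.above l.castSucc)
      = -(1 / 2) * ((∑ k, s.bd k * t.bd k : ℤ) : ℚ) := by
  simp only [s.bd_eq_sum_simpleRoot hs, t.bd_eq_sum_simpleRoot ht, correctionForm,
    correctionGram_eq, Finset.sum_mul_sum]
  rw [Finset.sum_comm]
  simp only [Finset.sum_comm (s := Finset.univ (α := Fin (n + 1)))]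
  push_cast
  simp only [Finset.mul_sum]
  rw [Finset.sum_comm]
  refine Finset.sum_congr rfl fun i _ => Finset.sum_congr rfl fun j _ =>
    Finset.sum_congr rfl fun k _ => ?_
  ring

/-! ### Propagation of film traces -/

theorem Slice.above_succ (s : Slice n) (i : Fin n) :
    s.above i.succ = s.above i.castSucc + s.bd i.succ := by
  rw [s.above_eq_below_add, s.below_succ]

theorem sum_simpleRoot_eq_zero (i : Fin n) : ∑ k, simpleRoot i k = 0 := by
  simpa using sum_mul_simpleRoot (fun _ => 1) i

theorem Slice.bd_start (i : Fin n) : (Slice.start i).bd = simpleRoot i := rfl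

theorem Slice.below_of_bd_eq_add {s t : Slice n} {i : Fin n} {c : ℤ}
    (h : t.bd = s.bd + c • simpleRoot i) : t.below i.castSucc = s.below i.castSucc := by
  unfold Slice.below
  refine Finset.sum_congr rfl fun k hk => ?_
  have hk' : k < i.castSucc := Finset.mem_Iio.1 hk
  have h1 : k ≠ i.castSucc := hk'.ne
  have h2 : k ≠ i.succ := (hk'.trans Fin.castSucc_lt_succ).ne
  simp [h, simpleRoot, h1, h2]

theorem Slice.above_castSucc_of_bd_eq_add {s t : Slice n} {i : Fin n} {c : ℤ}
    (h : t.bd = s.bd + c • simpleRoot i) : t.above i.castSucc = s.above i.castSucc + c := by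
  rw [t.above_eq_below_add, s.above_eq_below_add, Slice.below_of_bd_eq_add h, h]
  simp [simpleRoot, (Fin.castSucc_lt_succ (i := i)).ne, add_assoc]

theorem Slice.above_succ_of_bd_eq_add {s t : Slice n} {i : Fin n} {c : ℤ}
    (h : t.bd = s.bd + c • simpleRoot i) : t.above i.succ = s.above i.succ := by
  rw [t.above_succ, s.above_succ, Slice.above_castSucc_of_bd_eq_add h, h]
  simp [simpleRoot, (Fin.castSucc_lt_succ (i := i)).ne']
  ring

theorem Slice.total_of_bd_eq_add {s t : Slice n} {i : Fin n} {c : ℤ}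
    (h : t.bd = s.bd + c • simpleRoot i) : t.total = s.total := by
  simp [Slice.total, h, Finset.sum_add_distrib, ← Finset.mul_sum, sum_simpleRoot_eq_zero]

theorem Slice.exists_bd_throughBridge (i : Fin n) (s : Slice n) :
    ∃ c : ℤ, (s.throughBridge i).bd = s.bd + c • simpleRoot i := by
  unfold Slice.throughBridge
  split_ifs
  · exact ⟨0, by simp⟩
  · exact ⟨-s.above i.castSucc, by rw [neg_smul, ← sub_eq_add_neg]; rfl⟩

theorem Slice.bd_throughCrossing (i : Fin n) (s : Slice n) :
    (s.throughCrossing i).bd = s.bd ∘ simpleRefl i := rfl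

theorem Slice.total_throughCrossing (i : Fin n) (s : Slice n) :
    (s.throughCrossing i).total = s.total :=
  Equiv.sum_comp (simpleRefl i) s.bd

theorem Slice.total_throughBridge (i : Fin n) (s : Slice n) :
    (s.throughBridge i).total = s.total :=
  have ⟨_, h⟩ := s.exists_bd_throughBridge i
  Slice.total_of_bd_eq_add h

theorem leftSlice_total (u : Equiv.Perm (Fin (n + 1))) (β : Word n) (l : ℕ) :
    (leftSlice u β l).total = 0 := by
  induction β generalizing l with
  | nil => simp [leftSlice, Slice.empty, Slice.total]
  | cons i γ ih =>
    cases l with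
    | zero => exact sum_simpleRoot_eq_zero i
    | succ l =>
      unfold leftSlice
      split_ifs
      · rw [Slice.total_throughBridge, ih]
      · rw [Slice.total_throughCrossing, ih]

/-- The contribution of a bridge with letter `i` to the number of half arrows, in terms of the
traces `s`, `t` on its left side and `s'`, `t'` on its right side of the source and target films. -/
def localArrows (i : Fin n) (s s' t t' : Slice n) : ℤ :=
  2 * (s.above i.castSucc * t'.above i.castSucc) + s'.above i.castSucc * t.above i.succ
    + s.above i.succ * t.above i.castSucc + s'.above i.castSucc * t.below i.castSucc
    + s.below i.castSucc * t.above i.castSucc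

end Slices

/-! ### Adding a letter on the left -/

section Lift

variable {n : ℕ} {u : Equiv.Perm (Fin (n + 1))} {γ : Word n}

theorem film_total (x : Bridge u γ) (j : ℕ) : (film x j).total = 0 := by
  unfold film
  split_ifs
  · exact leftSlice_total _ _ _
  · simp [Slice.empty, Slice.total]

theorem correctionForm_boundary (x y : Bridge u γ) :
    correctionForm (boundary x) (boundary y)
      = -(1 / 2) * ((∑ k, (film x 0).bd k * (film y 0).bd k : ℤ) : ℚ) :=
  correctionForm_above (film_total x 0) (film_total y 0)

theorem halfArrows_eq (x y : Bridge u γ) :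
    halfArrows x y = ∑ p : Bridge u γ,
      localArrows p.letter (film x p.pos) (film x (p.pos + 1)) (film y p.pos)
        (film y (p.pos + 1)) := rfl

/-- The entry of `B̂^{u,γ}` at a pair of bridges. -/
noncomputable def bEntry (x y : Bridge u γ) : ℚ :=
  (1 / 2 : ℚ) * (halfArrows x y - halfArrows y x) + correctionForm (boundary x) (boundary y)

theorem bHat_apply (k l : Fin (numFilms u γ)) :
    bHat u γ k l = bEntry (label u γ k) (label u γ l) := rfl

/-- A bridge of `γ`, seen as a bridge of `σ_i γ`. -/
def Bridge.lift (i : Fin n) (x : Bridge u γ) : Bridge u (i :: γ) :=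
  ⟨x.pos.succ, x.2⟩

theorem Bridge.pos_lift (i : Fin n) (x : Bridge u γ) : ((x.lift i).pos : ℕ) = x.pos + 1 := rfl

theorem Bridge.letter_lift (i : Fin n) (x : Bridge u γ) : (x.lift i).letter = x.letter := rfl

theorem Bridge.lift_injective (i : Fin n) :
    Function.Injective (Bridge.lift i : Bridge u γ → Bridge u (i :: γ)) := by
  intro x y h
  have h2 : x.pos.succ = y.pos.succ := congrArg Subtype.val h
  exact Subtype.ext (Fin.succ_injective _ h2)

theorem Bridge.exists_lift_of_pos_ne_zero {i : Fin n} (x : Bridge u (i :: γ))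
    (h : (x.pos : ℕ) ≠ 0) : ∃ y : Bridge u γ, y.lift i = x := by
  obtain ⟨⟨j, hj⟩, hx⟩ := x
  cases j with
  | zero => exact absurd rfl h
  | succ j => exact ⟨⟨⟨j, Nat.lt_of_succ_lt_succ hj⟩, hx⟩, rfl⟩

theorem film_lift_succ (i : Fin n) (x : Bridge u γ) (j : ℕ) :
    film (x.lift i) (j + 1) = film x j := by
  simp only [film, Bridge.pos_lift, List.drop_succ_cons, Nat.add_le_add_iff_right,
    Nat.add_sub_add_right]

theorem film_zero (x : Bridge u γ) : film x 0 = leftSlice u γ x.pos := rfl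

theorem film_lift_zero_of_crossing {i : Fin n} (h : demazureSeq u γ ≠ demazureSeq u (i :: γ))
    (x : Bridge u γ) : film (x.lift i) 0 = (film x 0).throughCrossing i := by
  rw [film_zero, film_zero, Bridge.pos_lift, leftSlice, if_neg h]

theorem film_lift_zero_of_bridge {i : Fin n} (h : demazureSeq u γ = demazureSeq u (i :: γ))
    (x : Bridge u γ) : film (x.lift i) 0 = (film x 0).throughBridge i := by
  rw [film_zero, film_zero, Bridge.pos_lift, leftSlice, if_pos h]

/-- If the new letter is a crossing, the bridges are the old ones. -/
noncomputable def liftEquiv {i : Fin n} (h : demazureSeq u γ ≠ demazureSeq u (i :: γ)) :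
    Bridge u γ ≃ Bridge u (i :: γ) :=
  Equiv.ofBijective (Bridge.lift i) ⟨Bridge.lift_injective i, fun x =>
    x.exists_lift_of_pos_ne_zero fun h0 => h (by
      have := x.2
      have h1 : Subtype.val x = (⟨0, Nat.succ_pos _⟩ : Fin (i :: γ).length) := Fin.ext h0
      rw [h1] at this
      exact this)⟩

theorem bEntry_lift_of_crossing {i : Fin n} (h : demazureSeq u γ ≠ demazureSeq u (i :: γ))
    (x y : Bridge u γ) : bEntry (x.lift i) (y.lift i) = bEntry x y := by
  have hA : ∀ x y : Bridge u γ, halfArrows (x.lift i) (y.lift i) = halfArrows x y := by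
    intro x y
    rw [halfArrows_eq, halfArrows_eq, ← Equiv.sum_comp (liftEquiv h)]
    refine Finset.sum_congr rfl fun p _ => ?_
    rw [show liftEquiv h p = p.lift i from rfl]
    simp only [Bridge.pos_lift, Bridge.letter_lift, film_lift_succ]
  rw [bEntry, bEntry, hA, hA, correctionForm_boundary, correctionForm_boundary,
    film_lift_zero_of_crossing h, film_lift_zero_of_crossing h]
  simp only [Slice.bd_throughCrossing, Function.comp_apply]
  rw [Equiv.sum_comp (simpleRefl i) fun k => (film x 0).bd k * (film y 0).bd k]

/-- The bridge formed by the first letter of a word. -/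
def newBridge {i : Fin n} (h : demazureSeq u γ = demazureSeq u (i :: γ)) : Bridge u (i :: γ) :=
  ⟨⟨0, Nat.succ_pos _⟩, h⟩

/-- If the new letter is a bridge, the bridges are the new one and the old ones. -/
noncomputable def optionLiftEquiv {i : Fin n} (h : demazureSeq u γ = demazureSeq u (i :: γ)) :
    Option (Bridge u γ) ≃ Bridge u (i :: γ) :=
  Equiv.ofBijective (fun o => o.elim (newBridge h) (Bridge.lift i)) (by
    constructor
    · rintro (_ | x) (_ | y) hxy
      · rfl
      · have h2 := congrArg (fun z : Bridge u (i :: γ) => (z.pos : ℕ)) hxy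
        exact absurd h2 (Nat.succ_ne_zero _).symm
      · have h2 := congrArg (fun z : Bridge u (i :: γ) => (z.pos : ℕ)) hxy
        exact absurd h2 (Nat.succ_ne_zero _)
      · exact congrArg some (Bridge.lift_injective i hxy)
    · intro x
      by_cases h0 : (x.pos : ℕ) = 0
      · exact ⟨none, Subtype.ext (Fin.ext h0.symm)⟩
      · obtain ⟨y, hy⟩ := x.exists_lift_of_pos_ne_zero h0
        exact ⟨some y, hy⟩)

variable {i : Fin n} (h : demazureSeq u γ = demazureSeq u (i :: γ))

theorem film_newBridge_zero : film (newBridge h) 0 = Slice.start i := rfl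

theorem film_newBridge_succ (j : ℕ) : film (newBridge h) (j + 1) = Slice.empty :=
  if_neg (Nat.not_succ_le_zero j)

theorem halfArrows_of_bridge (h : demazureSeq u γ = demazureSeq u (i :: γ))
    (x y : Bridge u (i :: γ)) :
    halfArrows x y = localArrows i (film x 0) (film x 1) (film y 0) (film y 1) +
      ∑ p : Bridge u γ, localArrows p.letter (film x (p.pos + 1)) (film x (p.pos + 1 + 1))
        (film y (p.pos + 1)) (film y (p.pos + 1 + 1)) := by
  rw [halfArrows_eq, ← Equiv.sum_comp (optionLiftEquiv h), Fintype.sum_option]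
  rfl

theorem halfArrows_lift_lift (h : demazureSeq u γ = demazureSeq u (i :: γ)) (x y : Bridge u γ) :
    halfArrows (x.lift i) (y.lift i) =
      localArrows i (film (x.lift i) 0) (film x 0) (film (y.lift i) 0) (film y 0)
        + halfArrows x y := by
  rw [halfArrows_of_bridge h, halfArrows_eq x y]
  simp only [film_lift_succ, film_lift_succ i _ 0]

theorem Slice.empty_above (k : Fin (n + 1)) : (Slice.empty : Slice n).above k = 0 := by
  simp [Slice.empty, Slice.above]

theorem Slice.empty_below (k : Fin (n + 1)) : (Slice.empty : Slice n).below k = 0 := by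
  simp [Slice.empty, Slice.below]

theorem Slice.bd_start_eq_add (i : Fin n) :
    (Slice.start i).bd = (Slice.empty : Slice n).bd + (1 : ℤ) • simpleRoot i := by
  ext k
  simp [Slice.bd_start, Slice.empty]

theorem halfArrows_newBridge_lift (x : Bridge u γ) :
    halfArrows (newBridge h) (x.lift i) = 2 * (film x 0).above i.castSucc := by
  rw [halfArrows_of_bridge h]
  simp [film_newBridge_succ, film_newBridge_succ h 0, film_newBridge_zero, film_lift_succ i x 0,
    localArrows, Slice.empty_above, Slice.empty_below,
    Slice.below_of_bd_eq_add (Slice.bd_start_eq_add i),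
    Slice.above_castSucc_of_bd_eq_add (Slice.bd_start_eq_add i),
    Slice.above_succ_of_bd_eq_add (Slice.bd_start_eq_add i)]

theorem halfArrows_lift_newBridge (x : Bridge u γ) :
    halfArrows (x.lift i) (newBridge h)
      = (film (x.lift i) 0).above i.succ + (film (x.lift i) 0).below i.castSucc := by
  rw [halfArrows_of_bridge h]
  simp [film_newBridge_succ, film_newBridge_succ h 0, film_newBridge_zero,
    localArrows, Slice.empty_above, Slice.empty_below,
    Slice.below_of_bd_eq_add (Slice.bd_start_eq_add i),
    Slice.above_castSucc_of_bd_eq_add (Slice.bd_start_eq_add i),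
    Slice.above_succ_of_bd_eq_add (Slice.bd_start_eq_add i)]

theorem bEntry_newBridge_self : bEntry (newBridge h) (newBridge h) = -1 := by
  rw [bEntry, correctionForm_boundary, film_newBridge_zero, Slice.bd_start, sum_mul_simpleRoot]
  have := (Fin.castSucc_lt_succ (i := i)).ne
  simp [simpleRoot, this, this.symm]

theorem Slice.bd_pairing (s : Slice n) (i : Fin n) :
    s.bd i.castSucc - s.bd i.succ =
      2 * s.above i.castSucc - s.above i.succ - s.below i.castSucc := by
  have h1 := s.above_eq_below_add i.castSucc
  have h2 := s.above_succ i
  linarith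

theorem correctionForm_newBridge_left (x : Bridge u (i :: γ)) :
    correctionForm (boundary (newBridge h)) (boundary x) =
      -(1 / 2) * ((2 * (film x 0).above i.castSucc - (film x 0).above i.succ
        - (film x 0).below i.castSucc : ℤ) : ℚ) := by
  rw [correctionForm_boundary, film_newBridge_zero, Slice.bd_start, ← Slice.bd_pairing,
    ← sum_mul_simpleRoot]
  simp only [mul_comm]

theorem correctionForm_newBridge_right (x : Bridge u (i :: γ)) :
    correctionForm (boundary x) (boundary (newBridge h)) =
      -(1 / 2) * ((2 * (film x 0).above i.castSucc - (film x 0).above i.succ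
        - (film x 0).below i.castSucc : ℤ) : ℚ) := by
  rw [correctionForm_boundary, film_newBridge_zero, Slice.bd_start, ← Slice.bd_pairing,
    ← sum_mul_simpleRoot]

theorem sum_bd_mul_bd_add (f g : Fin (n + 1) → ℤ) (i : Fin n) (c d : ℤ) :
    ∑ k, (f + c • simpleRoot i) k * (g + d • simpleRoot i) k =
      ∑ k, f k * g k + d * (f i.castSucc - f i.succ) + c * (g i.castSucc - g i.succ)
        + 2 * c * d := by
  have h2 : ∑ k, simpleRoot i k * simpleRoot i k = 2 := by
    have := (Fin.castSucc_lt_succ (i := i)).ne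
    rw [sum_mul_simpleRoot]
    simp [simpleRoot, this, this.symm]
  rw [← sum_mul_simpleRoot f, ← sum_mul_simpleRoot g, show 2 * c * d = c * d * 2 by ring,
    ← h2, Finset.mul_sum, Finset.mul_sum, Finset.mul_sum, ← Finset.sum_add_distrib,
    ← Finset.sum_add_distrib, ← Finset.sum_add_distrib]
  refine Finset.sum_congr rfl fun k _ => ?_
  simp only [Pi.add_apply, Pi.smul_apply, smul_eq_mul]
  ring

/-- The block of the old bridges in `B̂^{u,γ}` is the Schur complement, with respect to the entry
`-1` of the new bridge, in `B̂^{u,σ_i γ}`. -/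
theorem bEntry_schur (y x : Bridge u γ) :
    bEntry (y.lift i) (x.lift i)
      + bEntry (y.lift i) (newBridge h) * bEntry (newBridge h) (x.lift i) = bEntry y x := by
  simp only [bEntry]
  rw [halfArrows_lift_lift h, halfArrows_lift_lift h, halfArrows_newBridge_lift,
    halfArrows_lift_newBridge, halfArrows_newBridge_lift, halfArrows_lift_newBridge,
    correctionForm_newBridge_left, correctionForm_newBridge_right, correctionForm_boundary,
    correctionForm_boundary]
  obtain ⟨c, hc⟩ := (film y 0).exists_bd_throughBridge i
  obtain ⟨d, hd⟩ := (film x 0).exists_bd_throughBridge i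
  rw [← film_lift_zero_of_bridge h] at hc hd
  rw [hc, hd, sum_bd_mul_bd_add, Slice.bd_pairing, Slice.bd_pairing]
  simp only [localArrows, Slice.below_of_bd_eq_add hc, Slice.below_of_bd_eq_add hd,
    Slice.above_castSucc_of_bd_eq_add hc, Slice.above_castSucc_of_bd_eq_add hd,
    Slice.above_succ_of_bd_eq_add hc, Slice.above_succ_of_bd_eq_add hd]
  push_cast
  ring

theorem isFrozen_newBridge : IsFrozen (newBridge h) := by
  intro h0
  have h1 : (Slice.start i).above i.castSucc = 0 := congrFun h0 i
  rw [Slice.above_castSucc_of_bd_eq_add (Slice.bd_start_eq_add i), Slice.empty_above] at h1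
  simp at h1

/-- The new bridge comes after all mutable films and before all other frozen ones. -/
theorem lt_newBridge_iff (x : Bridge u (i :: γ)) : x < newBridge h ↔ ¬ IsFrozen x := by
  change filmKey x < filmKey (newBridge h) ↔ _
  rw [filmKey, filmKey, Prod.Lex.toLex_lt_toLex, decide_eq_true (isFrozen_newBridge h)]
  have h0 : ¬ x.pos < (newBridge h).pos := Nat.not_lt_zero _
  by_cases hx : IsFrozen x <;> simp [hx, h0]

theorem label_symm_newBridge :
    ((label u (i :: γ)).symm (newBridge h) : ℕ) = numMutable u (i :: γ) := by
  set p := (label u (i :: γ)).symm (newBridge h) with hp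
  have e : {k : Fin (numFilms u (i :: γ)) // k < p} ≃ {x : Bridge u (i :: γ) // ¬ IsFrozen x} :=
    (label u (i :: γ)).toEquiv.subtypeEquiv fun k => by
      rw [← lt_newBridge_iff h, hp]
      exact (label u (i :: γ)).lt_symm_apply
  rw [numMutable, ← Fintype.card_congr e,
    Fintype.card_of_subtype (Finset.Iio p) fun _ => Finset.mem_Iio, Fin.card_Iio]

end Lift

/-! ### Elimination of the pivot -/

section Pivot

variable {ι κ : Type*} [Fintype ι] [DecidableEq ι]

theorem leftFactor_mul_apply (B M : Matrix ι ι ℚ) (p y x : ι) :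
    (leftFactor B p * M) y x = M y x + if y = p then 0 else B y p * M p x := by
  have hL : ∀ z, leftFactor B p y z =
      (if y = z then 1 else 0) + if p = z then (if y = p then 0 else B y p) else 0 := by
    intro z
    simp only [leftFactor, Matrix.of_apply]
    grind
  simp [Matrix.mul_apply, hL, add_mul, Finset.sum_add_distrib]

theorem mul_rightFactor_apply (B M : Matrix ι ι ℚ) (p y x : ι) :
    (M * rightFactor B p) y x = M y x + if x = p then 0 else M y p * B p x := by
  have hR : ∀ z, rightFactor B p z x =
      (if x = z then 1 else 0) + if p = z then (if x = p then 0 else B p x) else 0 := by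
    intro z
    simp only [rightFactor, Matrix.of_apply]
    grind
  simp [Matrix.mul_apply, hR, mul_add, Finset.sum_add_distrib]

theorem bordered_mul_bordered [Fintype κ] [DecidableEq κ] {M N : Matrix κ κ ℚ} (h : M * N = 1) :
    bordered M * bordered N = 1 := by
  ext (_ | y) (_ | x)
  · simp [Matrix.mul_apply, Fintype.sum_option, bordered]
  · simp [Matrix.mul_apply, Fintype.sum_option, bordered]
  · simp [Matrix.mul_apply, Fintype.sum_option, bordered]
  · have := congrFun (congrFun h y) x
    simpa [Matrix.mul_apply, Fintype.sum_option, bordered, Matrix.one_apply] using this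

/-- If the Schur complement of the pivot `B p p = -1` is `B'`, then eliminating the row and the
column of the pivot turns `B` into the bordered matrix of `B'`. -/
theorem leftFactor_mul_mul_rightFactor {B : Matrix ι ι ℚ} {B' : Matrix κ κ ℚ} {p : ι}
    {σ : Option κ ≃ ι} (hp : σ none = p) (hpp : B p p = -1)
    (hs : ∀ y x, B (σ (some y)) (σ (some x)) + B (σ (some y)) p * B p (σ (some x)) = B' y x) :
    leftFactor B p * B * rightFactor B p = (bordered B').reindex σ σ := by
  subst hp
  ext y x
  obtain ⟨y, rfl⟩ := σ.surjective y
  obtain ⟨x, rfl⟩ := σ.surjective x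
  rw [mul_rightFactor_apply, leftFactor_mul_apply, leftFactor_mul_apply]
  rcases y with _ | y <;> rcases x with _ | x <;>
    simp [hpp, bordered, ← hs]

/-- Inversion of a matrix by elimination of a pivot. -/
theorem inverse_formula [Fintype κ] [DecidableEq κ] {B : Matrix ι ι ℚ} {B' : Matrix κ κ ℚ} {p : ι}
    {σ : Option κ ≃ ι}
    (hZ : leftFactor B p * B * rightFactor B p = (bordered B').reindex σ σ)
    (hB' : IsUnit B'.det) :
    IsUnit B.det ∧
      (bordered B').reindex σ σ * ((bordered B').reindex σ σ)⁻¹ = 1 ∧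
      ((bordered B').reindex σ σ)⁻¹ = (bordered B'⁻¹).reindex σ σ ∧
      B⁻¹ = rightFactor B p * ((bordered B').reindex σ σ)⁻¹ * leftFactor B p := by
  have h1 : (bordered B').reindex σ σ * (bordered B'⁻¹).reindex σ σ = 1 := by
    simp only [Matrix.reindex_apply]
    rw [Matrix.submatrix_mul_equiv, bordered_mul_bordered (Matrix.mul_nonsing_inv _ hB'),
      Matrix.submatrix_one_equiv]
  have hinv := Matrix.inv_eq_right_inv h1
  have hu : IsUnit ((bordered B').reindex σ σ).det := Matrix.isUnit_det_of_right_inverse h1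
  have hu' := hu
  rw [← hZ, Matrix.det_mul, Matrix.det_mul, IsUnit.mul_iff, IsUnit.mul_iff] at hu'
  obtain ⟨⟨hL, hB⟩, hR⟩ := hu'
  refine ⟨hB, Matrix.mul_nonsing_inv _ hu, hinv, ?_⟩
  rw [← hZ, Matrix.mul_inv_rev, Matrix.mul_inv_rev, ← Matrix.mul_assoc, ← Matrix.mul_assoc,
    Matrix.mul_nonsing_inv _ hR, Matrix.one_mul, Matrix.mul_assoc, Matrix.nonsing_inv_mul _ hL,
    Matrix.mul_one]

end Pivot

/-! ### The matrices of a braid word -/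

section Word

variable {n : ℕ} {u : Equiv.Perm (Fin (n + 1))} {γ : Word n} {i : Fin n}
  (h : demazureSeq u γ = demazureSeq u (i :: γ))

/-- The identification of the labels of the old and of the new word, the extra index `none` being
the new bridge. -/
noncomputable def labelEquiv : Option (Fin (numFilms u γ)) ≃ Fin (numFilms u (i :: γ)) :=
  ((label u γ).toEquiv.optionCongr.trans (optionLiftEquiv h)).trans
    (label u (i :: γ)).symm.toEquiv

theorem labelEquiv_none : labelEquiv h none = (label u (i :: γ)).symm (newBridge h) := rfl

theorem label_labelEquiv_some (x : Fin (numFilms u γ)) :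
    label u (i :: γ) (labelEquiv h (some x)) = (label u γ x).lift i :=
  (label u (i :: γ)).apply_symm_apply _

theorem leftFactor_mul_bHat_mul_rightFactor :
    leftFactor (bHat u (i :: γ)) (labelEquiv h none) * bHat u (i :: γ) *
      rightFactor (bHat u (i :: γ)) (labelEquiv h none)
      = (bordered (bHat u γ)).reindex (labelEquiv h) (labelEquiv h) := by
  have hp : label u (i :: γ) (labelEquiv h none) = newBridge h := by
    rw [labelEquiv_none, OrderIso.apply_symm_apply]
  refine leftFactor_mul_mul_rightFactor rfl ?_ fun y x => ?_
  · rw [bHat_apply, hp, bEntry_newBridge_self]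
  · simp only [bHat_apply, hp, label_labelEquiv_some, bEntry_schur]

theorem isUnit_det_bHat (u : Equiv.Perm (Fin (n + 1))) (γ : Word n) :
    IsUnit (bHat u γ).det := by
  induction γ with
  | nil =>
    have : IsEmpty (Bridge u ([] : Word n)) := ⟨fun x => x.pos.elim0⟩
    have : IsEmpty (Fin (numFilms u ([] : Word n))) := (label u []).toEquiv.isEmpty
    simp
  | cons i γ ih =>
    by_cases h : demazureSeq u γ = demazureSeq u (i :: γ)
    · exact (inverse_formula (leftFactor_mul_bHat_mul_rightFactor h) ih).1
    · let e : Fin (numFilms u γ) ≃ Fin (numFilms u (i :: γ)) :=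
        ((label u γ).toEquiv.trans (liftEquiv h)).trans (label u (i :: γ)).symm.toEquiv
      have he : ∀ k, label u (i :: γ) (e k) = (label u γ k).lift i := fun k =>
        (label u (i :: γ)).apply_symm_apply _
      have hB : bHat u γ = (bHat u (i :: γ)).submatrix e e := by
        ext k l
        rw [Matrix.submatrix_apply, bHat_apply, bHat_apply, he, he, bEntry_lift_of_crossing h]
      rwa [hB, Matrix.det_submatrix_equiv_self] at ih

end Word

end BraidQuiver

theorem mainTheorem2 {n : ℕ} (u : Equiv.Perm (Fin (n + 1))) (i : Fin n) (β' : BraidQuiver.Word n)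
    (hu : BraidQuiver.IsSubword u β') :
    ∃ (p : Fin (BraidQuiver.numFilms u (i :: β')))
      (σ : Option (Fin (BraidQuiver.numFilms u β')) ≃ Fin (BraidQuiver.numFilms u (i :: β'))),
      -- `p` is the index of the first frozen film, which starts at the new leftmost bridge
      (p : ℕ) = BraidQuiver.numMutable u (i :: β') ∧
      ((BraidQuiver.label u (i :: β') p).pos : ℕ) = 0 ∧
      -- `σ` identifies the old bridges with the remaining ones
      σ none = p ∧
      (∀ x, ((BraidQuiver.label u (i :: β') (σ (some x))).pos : ℕ)
        = ((BraidQuiver.label u β' x).pos : ℕ) + 1) ∧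
      let B := BraidQuiver.bHat u (i :: β')
      let A := BraidQuiver.aMatrix u (i :: β')
      let B' := BraidQuiver.bHat u β'
      let A' := BraidQuiver.aMatrix u β'
      let L := BraidQuiver.leftFactor B p
      let R := BraidQuiver.rightFactor B p
      let Z₁ := (BraidQuiver.bordered B').reindex σ σ
      -- the inverse matrices exist
      (B * A = 1 ∧ A * B = 1) ∧ (B' * A' = 1 ∧ A' * B' = 1) ∧
      Z₁ * Z₁⁻¹ = 1 ∧ Z₁⁻¹ = (BraidQuiver.bordered A').reindex σ σ ∧
      A = R * Z₁⁻¹ * L := by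

  have h1 := BraidQuiver.demazureSeq_eq_one_of_isSubword hu
  have h : BraidQuiver.demazureSeq u β' = BraidQuiver.demazureSeq u (i :: β') := by
    rw [BraidQuiver.demazureSeq, h1, BraidQuiver.demazureQuot_one]
  have hB := BraidQuiver.isUnit_det_bHat u (i :: β')
  have hB' := BraidQuiver.isUnit_det_bHat u β'
  obtain ⟨-, hZ, hZinv, hA⟩ := BraidQuiver.inverse_formula
    (BraidQuiver.leftFactor_mul_bHat_mul_rightFactor h) hB'
  refine ⟨BraidQuiver.labelEquiv h none, BraidQuiver.labelEquiv h,
    BraidQuiver.label_symm_newBridge h, ?_, rfl, fun x => ?_,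
    ⟨Matrix.mul_nonsing_inv _ hB, Matrix.nonsing_inv_mul _ hB⟩,
    ⟨Matrix.mul_nonsing_inv _ hB', Matrix.nonsing_inv_mul _ hB'⟩, hZ, hZinv, hA⟩
  · rw [BraidQuiver.labelEquiv_none, OrderIso.apply_symm_apply]
    rfl
  · rw [BraidQuiver.label_labelEquiv_some, BraidQuiver.Bridge.pos_lift]
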